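/- Let $A\in\{0,\star\}^{d\times d}$ and $B\in\{0,\star\}^{d\times m}$ be sparsity matrices, where $\star$ denotes a free real entry and $0$ a fixed zero. A pair $(A,B)$ is called structurally controllable if real values can be assigned to its $\star$ entries so that the resulting linear system $\dot x=A'x+B'u$ is controllable. Assume that $(A,B)$ is structurally controllable. Let each nonzero entry $B_{ij}$ carry a cost $w_{ij}$. For $B'\in\{0,\star\}^{d\times m}$ whose nonzero entries are among those of $B$, let $\|B'\|_0$ be the number of its nonzero entries and $\|B'\|_w=\sum_{(i,j):B'_{ij}\ne0}w_{ij}$. Let $\mathcal K$ be the set of such $B'$ for which $(A,B')$ is structurally controllable. Let $G(A)$ be the digraph on $v_1,\dots,v_d$ with an edge $v_j\to v_i$ whenever $A_{ij}\neq0$. Let $\Gamma(A,B)$ be the bipartite graph with vertex classes $\{v_1^1,\dots,v_d^1,u_1,\dots,u_m\}$ and $\{v_1^2,\dots,v_d^2\}$ and edge set $\mathcal E_A\sqcup\mathcal E_B$, where $\mathcal E_A=\{(v_j^1,v_i^2): A_{ij}\ne0\}$ and $\mathcal E_B=\{(u_j,v_i^2): B_{ij}\neq0\}$. Let $\Gamma(A)$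 be its induced subgraph on the vertices $v_j^1$ and $v_i^2$, whose edge set is $\mathcal E_A$. Assume that $G(A)$ is strongly connected, that $\Gamma(A)$ has no perfect matching, and that $w_{ij}>0$ whenever $B_{ij}\ne0$. Give cost $0$ to each edge in $\mathcal E_A$ and cost $w_{ij}$ to each edge $(u_j,v_i^2)\in\mathcal E_B$. Let $M^*$ be any matching of least total cost among the maximum matchings of $\Gamma(A,B)$, and let $B^*$ be the matrix with $B^*_{\ell k}=\star$ if $(u_k,v_\ell^2)\in M^*$ and $B^*_{\ell k}=0$ otherwise. Then: (1) $B^*\in\mathcal K$ and $\|B^*\|_w\le\|B'\|_w$ for all $B'\in\mathcal K$; (2) $\|B^*\|_0\le\|B'\|_0$ for all $B'\in\mathcal K$, and $B^*$ minimizes $\|\cdot\|_w$ over those elements of $\mathcal K$ that have the fewest nonzero entries; (3) $M^*\cap\mathcal E_A$ is a maximum matching of $\Gamma(A)$. -/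

import Mathlib

namespace StructuralControl

/-- A sparsity matrix, an element of `{0, ⋆}^{n × k}`: `true` stands for a free entry `⋆`,
`false` for a fixed zero. -/
abbrev SparsityMatrix (n k : ℕ) : Type := Matrix (Fin n) (Fin k) Bool

/-- `R'` is a numerical realisation of `R`: arbitrary real values at the `⋆` entries,
and `0` at the fixed zeros. -/
def IsRealisation {n k : ℕ} (R : SparsityMatrix n k) (R' : Matrix (Fin n) (Fin k) ℝ) : Prop :=
  ∀ i j, R i j = false → R' i j = 0

/-- Controllability of the system `x'(t) = A x(t) + B u(t)`: every initial state can be steered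
to every final state in finite time by some continuous input. -/
def IsControllable {d m : ℕ} (A : Matrix (Fin d) (Fin d) ℝ) (B : Matrix (Fin d) (Fin m) ℝ) :
    Prop :=
  ∀ x₀ x₁ : Fin d → ℝ, ∃ T : ℝ, 0 < T ∧ ∃ (u : ℝ → Fin m → ℝ) (x : ℝ → Fin d → ℝ),
    ContinuousOn u (Set.Icc 0 T) ∧
    (∀ t ∈ Set.Icc 0 T,
      HasDerivWithinAt x (A.mulVec (x t) + B.mulVec (u t)) (Set.Icc 0 T) t) ∧
    x 0 = x₀ ∧ x T = x₁

/-- Some numerical realisation of the pair `(A, B)` is controllable. -/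
def IsStructurallyControllable {d m : ℕ} (A : SparsityMatrix d d) (B : SparsityMatrix d m) :
    Prop :=
  ∃ (A' : Matrix (Fin d) (Fin d) ℝ) (B' : Matrix (Fin d) (Fin m) ℝ),
    IsRealisation A A' ∧ IsRealisation B B' ∧ IsControllable A' B'

/-- The digraph `G(A)` on the state vertices, with an edge `v_j → v_i` iff `A i j ≠ 0`. -/
def stateDigraph {d : ℕ} (A : SparsityMatrix d d) : Digraph (Fin d) where
  Adj j i := A i j = true

/-- Every ordered pair of vertices is joined by a directed path (possibly the trivial path,
from a vertex to itself). -/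
def IsStronglyConnected {V : Type*} (G : Digraph V) : Prop :=
  ∀ a b : V, Relation.ReflTransGen G.Adj a b

section Matchings

variable {L R : Type*}

/-- `M` is a matching in the bipartite graph with vertex classes `L`, `R` and edge set `E`. -/
def IsMatching (E M : Finset (L × R)) : Prop :=
  M ⊆ E ∧ ∀ e ∈ M, ∀ f ∈ M, e ≠ f → e.1 ≠ f.1 ∧ e.2 ≠ f.2

/-- A matching with the largest number of edges. -/
def IsMaximumMatching (E M : Finset (L × R)) : Prop :=
  IsMatching E M ∧ ∀ N : Finset (L × R), IsMatching E N → N.card ≤ M.card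

/-- A matching that saturates all vertices of both classes. -/
def IsPerfectMatching (E M : Finset (L × R)) : Prop :=
  IsMatching E M ∧ (∀ l : L, ∃ e ∈ M, e.1 = l) ∧ (∀ r : R, ∃ e ∈ M, e.2 = r)

/-- A maximum matching whose total cost is least among all maximum matchings. -/
def IsMinCostMaximumMatching (E : Finset (L × R)) (c : L × R → ℝ) (M : Finset (L × R)) : Prop :=
  IsMaximumMatching E M ∧
    ∀ N : Finset (L × R), IsMaximumMatching E N → ∑ e ∈ M, c e ≤ ∑ e ∈ N, c e

end Matchings

/-- The edges `(v_j^1, v_i^2)`, `A i j ≠ 0`, of the bipartite graph `Γ(A)`. -/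
def stateEdges {d : ℕ} (A : SparsityMatrix d d) : Finset (Fin d × Fin d) :=
  Finset.univ.filter fun e => A e.2 e.1 = true

/-- The edges of the bipartite graph `Γ(A, B)`: the left class is `V_A^1 ⊔ V_B`, the right class
is `V_A^2`; the edges are `(v_j^1, v_i^2)` for `A i j ≠ 0` and `(u_j, v_i^2)` for `B i j ≠ 0`. -/
def systemEdges {d m : ℕ} (A : SparsityMatrix d d) (B : SparsityMatrix d m) :
    Finset ((Fin d ⊕ Fin m) × Fin d) :=
  Finset.univ.filter fun e => Sum.elim (A e.2) (B e.2) e.1 = true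

/-- The cost of an edge of `Γ(A, B)`: zero on edges from `V_A^1`, and `w k j` on `(u_j, v_k^2)`. -/
def edgeCost {d m : ℕ} (w : Matrix (Fin d) (Fin m) ℝ) (e : (Fin d ⊕ Fin m) × Fin d) : ℝ :=
  Sum.elim (fun _ => 0) (w e.2) e.1

/-- The input matrix read off from a matching `M` of `Γ(A, B)`: the entry `(l, k)` is `⋆` iff
`(u_k, v_l^2)` belongs to `M`. -/
def inputMatrixOf {d m : ℕ} (M : Finset ((Fin d ⊕ Fin m) × Fin d)) : SparsityMatrix d m :=
  fun l k => decide ((Sum.inr k, l) ∈ M)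

/-- The edges of `M` that come from `Γ(A)`, as edges of `Γ(A)`. -/
def statePart {d m : ℕ} (M : Finset ((Fin d ⊕ Fin m) × Fin d)) : Finset (Fin d × Fin d) :=
  Finset.univ.filter fun e => (Sum.inl e.1, e.2) ∈ M

/-- The number of nonzero entries. -/
def nnz {n k : ℕ} (N : SparsityMatrix n k) : ℕ :=
  (Finset.univ.filter fun p : Fin n × Fin k => N p.1 p.2 = true).card

/-- The sum of the costs of the nonzero entries. -/
def weight {n k : ℕ} (w : Matrix (Fin n) (Fin k) ℝ) (N : SparsityMatrix n k) : ℝ :=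
  ∑ i, ∑ j, w i j * (if N i j = true then 1 else 0)

/-- The admissible input matrices: those that vanish wherever `B` does and that keep the pair
structurally controllable. -/
def admissible {d m : ℕ} (A : SparsityMatrix d d) (B : SparsityMatrix d m) :
    Set (SparsityMatrix d m) :=
  {B' | (∀ i j, B i j = false → B' i j = false) ∧ IsStructurallyControllable A B'}

/-- `Bs` has least cost among the admissible matrices. -/
def SolvesMinCost {d m : ℕ} (A : SparsityMatrix d d) (B : SparsityMatrix d m)
    (w : Matrix (Fin d) (Fin m) ℝ) (Bs : SparsityMatrix d m) : Prop :=
  Bs ∈ admissible A B ∧ ∀ B' ∈ admissible A B, weight w Bs ≤ weight w B'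

/-- The admissible matrices with the fewest nonzero entries. -/
def sparsest {d m : ℕ} (A : SparsityMatrix d d) (B : SparsityMatrix d m) :
    Set (SparsityMatrix d m) :=
  {B' | B' ∈ admissible A B ∧ ∀ B'' ∈ admissible A B, nnz B' ≤ nnz B''}

/-- `Bs` has least cost among the admissible matrices with the fewest nonzero entries. -/
def SolvesSparsestMinCost {d m : ℕ} (A : SparsityMatrix d d) (B : SparsityMatrix d m)
    (w : Matrix (Fin d) (Fin m) ℝ) (Bs : SparsityMatrix d m) : Prop :=
  Bs ∈ sparsest A B ∧ ∀ B' ∈ sparsest A B, weight w Bs ≤ weight w B'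

end StructuralControl

/-! Structural controllability is reduced to matchings. If `(A, B')` is structurally controllable,
no nonzero row vector annihilates both `A'` and `B'` for some realisation, so the rows of `[A' B']`
are independent, and Hall's theorem gives a matching of `Γ(A, B')` covering all `d` right vertices
(`IsStructurallyControllable.exists_matching`).

Conversely, let `G(A)` be strongly connected and let a saturating matching use at least one input
edge. Its edges form paths issuing from inputs together with disjoint cycles. The paths are
controllable, and each cycle can be hung on the part already built, with a weight so large that its
modes are not cancelled (`ControllableOn.union_cycle`). As `Γ(A)` has no perfect matching, `M` does
use an input edge, so its input matrix is admissible.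

Every admissible `B'` thus contains the input edges of a saturating matching of `Γ(A, B)`, whose
cost is at least that of `M`. For cardinality, a saturating matching has `d` minus (number of state
edges) input edges, so it suffices that the state part of `M` is maximum in `Γ(A)`. If it were not,
an augmentation keeping all covered right vertices would free a positively priced input edge
(`isMaximumMatching_statePart`). -/

namespace StructuralControl

/-! ### Augmentation and saturation in bipartite graphs -/

section Matchings

variable {L R : Type*}

/-- A matching that is not maximum can be enlarged so that it still covers every right vertex
covered before, and one more. -/
theorem exists_augmentation [DecidableEq L] [DecidableEq R] (E : Finset (L × R)) (n : ℕ) :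
    ∀ M N : Finset (L × R), M.card = n → IsMatching E M → IsMatching E N → M.card < N.card →
      ∃ M' ⊆ M ∪ N, IsMatching E M' ∧
        ∃ r, r ∉ M.image Prod.snd ∧ M'.image Prod.snd = insert r (M.image Prod.snd) := by
  induction n with
  | zero =>
    intro M N hn hM hN hlt
    obtain ⟨e, he⟩ := Finset.card_pos.mp (lt_of_le_of_lt (Nat.zero_le _) hlt)
    have hM0 : M = ∅ := Finset.card_eq_zero.mp hn
    subst hM0
    refine ⟨{e}, by simpa using he, ⟨by simpa using hN.1 he, ?_⟩, e.2, by simp, by simp⟩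
    intro a ha b hb hab
    simp only [Finset.mem_singleton] at ha hb
    exact absurd (ha.trans hb.symm) hab
  | succ n ih =>
    intro M N hn hM hN hlt
    have hcM : (M.image Prod.snd).card = M.card := Finset.card_image_of_injOn fun a ha b hb h => by
      by_contra hab
      exact (hM.2 a ha b hb hab).2 h
    have hcN : (N.image Prod.snd).card = N.card := Finset.card_image_of_injOn fun a ha b hb h => by
      by_contra hab
      exact (hN.2 a ha b hb hab).2 h
    obtain ⟨r, hrN, hrM⟩ := Finset.exists_mem_notMem_of_card_lt_card
      (s := M.image Prod.snd) (t := N.image Prod.snd) (by omega)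
    obtain ⟨⟨l, r₁⟩, heN, hr₁⟩ := Finset.mem_image.mp hrN
    obtain rfl : r₁ = r := hr₁
    have key : ∀ (M₀ : Finset (L × R)) (s : R), IsMatching E M₀ → (l, s) ∈ E →
        (∀ e ∈ M₀, e.1 ≠ l) → s ∉ M₀.image Prod.snd → IsMatching E (insert (l, s) M₀) := by
      intro M₀ s h0 hE hl hs
      have hs' : ∀ e ∈ M₀, e.2 ≠ s := fun e he h => hs (Finset.mem_image.mpr ⟨e, he, h⟩)
      refine ⟨Finset.insert_subset hE h0.1, ?_⟩
      intro a ha b hb hab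
      rcases Finset.mem_insert.mp ha with rfl | ha <;> rcases Finset.mem_insert.mp hb with rfl | hb
      · exact absurd rfl hab
      · exact ⟨(hl b hb).symm, (hs' b hb).symm⟩
      · exact ⟨hl a ha, hs' a ha⟩
      · exact h0.2 a ha b hb hab
    by_cases hl : ∃ e ∈ M, e.1 = l
    · obtain ⟨⟨l', r'⟩, heM, hl'⟩ := hl
      obtain rfl : l' = l := hl'
      have sub : ∀ {M₀ M₁ : Finset (L × R)}, M₁ ⊆ M₀ → IsMatching E M₀ → IsMatching E M₁ :=
        fun h h0 => ⟨h.trans h0.1, fun a ha b hb => h0.2 a (h ha) b (h hb)⟩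
      have hr' : r' ≠ r₁ := fun h => hrM (Finset.mem_image.mpr ⟨_, heM, h⟩)
      have hMl : ∀ e ∈ M.erase (l', r'), e.1 ≠ l' := fun e he =>
        (hM.2 e (Finset.mem_of_mem_erase he) _ heM (Finset.ne_of_mem_erase he)).1
      have hNl : ∀ e ∈ N.erase (l', r₁), e.1 ≠ l' := fun e he =>
        (hN.2 e (Finset.mem_of_mem_erase he) _ heN (Finset.ne_of_mem_erase he)).1
      have hNr : ∀ e ∈ N.erase (l', r₁), e.2 ≠ r₁ := fun e he =>
        (hN.2 e (Finset.mem_of_mem_erase he) _ heN (Finset.ne_of_mem_erase he)).2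
      have hMr : r' ∉ (M.erase (l', r')).image Prod.snd := by
        intro h
        obtain ⟨e, he, h⟩ := Finset.mem_image.mp h
        exact (hM.2 e (Finset.mem_of_mem_erase he) _ heM (Finset.ne_of_mem_erase he)).2 h
      have himg : M.image Prod.snd = insert r' ((M.erase (l', r')).image Prod.snd) := by
        conv_lhs => rw [← Finset.insert_erase heM]
        rw [Finset.image_insert]
      -- With the edges at `l'` removed from both matchings, the inclusion `M' ⊆ M ∪ N` in the
      -- induction keeps `M'` off `l'`. One edge at `l'` can then be added: the one to `r₁` if the
      -- new vertex `s` is `r'` itself, and otherwise the old one to `r'`.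
      obtain ⟨M', hsub, hM', s, hs, hs'⟩ := ih (M.erase (l', r')) (N.erase (l', r₁))
        (by rw [Finset.card_erase_of_mem heM, hn]; rfl) (sub (Finset.erase_subset _ _) hM)
        (sub (Finset.erase_subset _ _) hN)
        (by rw [Finset.card_erase_of_mem heM, Finset.card_erase_of_mem heN]; omega)
      have hM'l : ∀ e ∈ M', e.1 ≠ l' := fun e he =>
        (Finset.mem_union.mp (hsub he)).elim (hMl e) (hNl e)
      have hsub' : M' ⊆ M ∪ N := hsub.trans
        (Finset.union_subset_union (Finset.erase_subset _ _) (Finset.erase_subset _ _))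
      have hsr : s ≠ r₁ := by
        have : s ∈ M'.image Prod.snd := by rw [hs']; exact Finset.mem_insert_self _ _
        obtain ⟨e, he, rfl⟩ := Finset.mem_image.mp this
        rcases Finset.mem_union.mp (hsub he) with h | h
        · exact absurd (Finset.mem_image_of_mem _ h) hs
        · exact hNr e h
      by_cases hsr' : s = r'
      · subst hsr'
        refine ⟨insert (l', r₁) M', Finset.insert_subset (Finset.mem_union_right _ heN) hsub',
          key M' r₁ hM' (hN.1 heN) hM'l ?_, r₁, hrM, ?_⟩
        · rw [hs', ← himg]; exact hrM
        · rw [Finset.image_insert, hs', ← himg]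
      · refine ⟨insert (l', r') M', Finset.insert_subset (Finset.mem_union_left _ heM) hsub',
          key M' r' hM' (hM.1 heM) hM'l ?_, s, ?_, ?_⟩
        · rw [hs', Finset.mem_insert]
          exact fun h => h.elim (fun h => hsr' h.symm) hMr
        · rw [himg, Finset.mem_insert]
          exact fun h => h.elim hsr' hs
        · rw [Finset.image_insert, hs', himg, Finset.insert_comm]
    · push Not at hl
      exact ⟨insert (l, r₁) M, Finset.insert_subset (Finset.mem_union_right _ heN)
        Finset.subset_union_left, key M r₁ hM (hN.1 heN) hl hrM, r₁, hrM,
        Finset.image_insert _ _ _⟩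

theorem IsMatching.injOn_snd {E M : Finset (L × R)} (hM : IsMatching E M) :
    Set.InjOn Prod.snd (M : Set (L × R)) := fun a ha b hb h => by
  by_contra hab
  exact (hM.2 a ha b hb hab).2 h

theorem IsMatching.card_le [Fintype R] {E M : Finset (L × R)} (hM : IsMatching E M) :
    M.card ≤ Fintype.card R := by
  classical
  rw [← Finset.card_image_of_injOn hM.injOn_snd]
  exact Finset.card_le_univ _

theorem IsMatching.exists_of_card_eq [Fintype R] {E M : Finset (L × R)} (hM : IsMatching E M)
    (hc : M.card = Fintype.card R) (r : R) : ∃ l, (l, r) ∈ M := by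
  classical
  rw [← Finset.card_image_of_injOn hM.injOn_snd, Finset.card_eq_iff_eq_univ] at hc
  obtain ⟨e, he, rfl⟩ := Finset.mem_image.mp (hc ▸ Finset.mem_univ r)
  exact ⟨e.1, he⟩

theorem card_eq_of_forall_exists [Fintype R] {E M : Finset (L × R)} (hM : IsMatching E M)
    (h : ∀ r, ∃ l, (l, r) ∈ M) : M.card = Fintype.card R := by
  classical
  rw [← Finset.card_image_of_injOn hM.injOn_snd, Finset.card_eq_iff_eq_univ,
    Finset.eq_univ_iff_forall]
  exact fun r => (h r).elim fun l hl => Finset.mem_image.mpr ⟨_, hl, rfl⟩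

theorem IsMatching.isMaximum_of_card_eq [Fintype R] {E M : Finset (L × R)} (hM : IsMatching E M)
    (hc : M.card = Fintype.card R) : IsMaximumMatching E M :=
  ⟨hM, fun _ hN => hc ▸ hN.card_le⟩

end Matchings

/-! ### Necessity: controllability forces a saturating matching -/

variable {d m : ℕ}

/-- A vector annihilating all columns of `A` and of `B` is zero if the system is controllable. -/
theorem IsControllable.eq_zero_of_vecMul {A : Matrix (Fin d) (Fin d) ℝ}
    {B : Matrix (Fin d) (Fin m) ℝ} (h : IsControllable A B) (v : Fin d → ℝ)
    (hA : Matrix.vecMul v A = 0) (hB : Matrix.vecMul v B = 0) : v = 0 := by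
  -- Steer `0` to `v` itself: `v ⬝ᵥ x` is constant along the trajectory, hence `v ⬝ᵥ v = 0`.
  obtain ⟨T, hT, u, x, -, hx, h0, h1⟩ := h 0 v
  have hder : ∀ t ∈ Set.Icc 0 T, HasDerivWithinAt (fun t => v ⬝ᵥ x t) 0 (Set.Icc 0 T) t := by
    intro t ht
    have := HasDerivWithinAt.fun_sum (u := Finset.univ) (A := fun i t => v i * x t i)
      (fun i _ => ((hasDerivWithinAt_pi.mp (hx t ht)) i).const_mul (v i))
    refine this.congr_deriv ?_
    change v ⬝ᵥ (A.mulVec (x t) + B.mulVec (u t)) = 0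
    rw [dotProduct_add, Matrix.dotProduct_mulVec, Matrix.dotProduct_mulVec, hA, hB]
    simp
  have hc := (convex_Icc (0 : ℝ) T).is_const_of_fderivWithin_eq_zero (𝕜 := ℝ)
    (f := fun t => v ⬝ᵥ x t) (fun t ht => (hder t ht).differentiableWithinAt)
    (fun t ht => by
      have := (hder t ht).hasFDerivWithinAt.fderivWithin
        ((uniqueDiffOn_Icc hT) t ht)
      rw [this]; ext; simp)
    (Set.left_mem_Icc.mpr hT.le) (Set.right_mem_Icc.mpr hT.le)
  simp only [h0, h1, dotProduct_zero] at hc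
  exact dotProduct_self_eq_zero.mp hc.symm

/-- If the rows of a matrix are linearly independent, then its support contains a system of
distinct column representatives of the rows. -/
theorem exists_injective_of_vecMul_injective {n k : Type*} [Fintype n] [Fintype k] [DecidableEq k]
    (C : Matrix n k ℝ) (hC : ∀ v : n → ℝ, Matrix.vecMul v C = 0 → v = 0) :
    ∃ f : n → k, Function.Injective f ∧ ∀ i, C i (f i) ≠ 0 := by
  classical
  have := (Finset.all_card_le_biUnion_card_iff_exists_injective
    (fun i : n => Finset.univ.filter fun j => C i j ≠ 0)).mp ?_
  · obtain ⟨f, hf, h⟩ := this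
    exact ⟨f, hf, fun i => by simpa using h i⟩
  intro I
  set J := I.biUnion fun i : n => Finset.univ.filter fun j => C i j ≠ 0
  -- Hall's condition is a dimension count: the rows in `I` vanish outside `J`, so they remain
  -- independent after restriction to `J`.
  let φ : (I → ℝ) →ₗ[ℝ] (J → ℝ) := Matrix.vecMulLinear (C.submatrix (fun i : I => (i : n))
    (fun j : J => (j : k)))
  have hφ : Function.Injective φ := by
    rw [← LinearMap.ker_eq_bot, LinearMap.ker_eq_bot']
    intro v hv
    have h0 := hC (fun i => if h : i ∈ I then v ⟨i, h⟩ else 0) ?_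
    · ext i
      simpa using congrFun h0 i
    ext j
    have hsum : Matrix.vecMul (fun i => if h : i ∈ I then v ⟨i, h⟩ else 0) C j
        = ∑ i : I, v i * C i j := by
      simp only [Matrix.vecMul, dotProduct]
      rw [← Finset.sum_subset (Finset.subset_univ I) (fun i _ hi => by simp [hi]),
        ← Finset.sum_coe_sort I]
      exact Finset.sum_congr rfl fun i _ => by simp
    rw [hsum, Pi.zero_apply]
    by_cases hj : j ∈ J
    · exact congrFun hv ⟨j, hj⟩
    · refine Finset.sum_eq_zero fun i _ => ?_
      have : C i j = 0 := by
        by_contra h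
        exact hj (Finset.mem_biUnion.mpr ⟨i, i.2, by simpa using h⟩)
      rw [this, mul_zero]
  have := LinearMap.finrank_le_finrank_of_injective hφ
  simpa using this

/-- A structurally controllable pair has a matching saturating all right vertices. -/
theorem IsStructurallyControllable.exists_matching {A : SparsityMatrix d d}
    {B : SparsityMatrix d m} (h : IsStructurallyControllable A B) :
    ∃ N, IsMatching (systemEdges A B) N ∧ N.card = d := by
  classical
  obtain ⟨A', B', hA, hB, hc⟩ := h
  obtain ⟨f, hf, hne⟩ := exists_injective_of_vecMul_injective (Matrix.fromCols A' B') fun v hv => by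
    rw [Matrix.vecMul_fromCols] at hv
    exact hc.eq_zero_of_vecMul v (funext fun i => congrFun hv (Sum.inl i))
      (funext fun i => congrFun hv (Sum.inr i))
  refine ⟨Finset.univ.image fun i => (f i, i), ⟨?_, ?_⟩, ?_⟩
  · intro e he
    obtain ⟨i, -, rfl⟩ := Finset.mem_image.mp he
    have := hne i
    simp only [systemEdges, Finset.mem_filter, Finset.mem_univ, true_and]
    by_contra h
    rw [Bool.not_eq_true] at h
    revert h this
    rcases f i with j | j
    · exact fun h h' => h (hA _ _ h')
    · exact fun h h' => h (hB _ _ h')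
  · intro a ha b hb hab
    obtain ⟨i, -, rfl⟩ := Finset.mem_image.mp ha
    obtain ⟨j, -, rfl⟩ := Finset.mem_image.mp hb
    have : i ≠ j := fun h => hab (by rw [h])
    exact ⟨fun h => this (hf h), this⟩
  · rw [Finset.card_image_of_injective _ fun i j h => congrArg Prod.snd h, Finset.card_univ,
      Fintype.card_fin]

end StructuralControl

namespace StructuralControl

/-! ### Eigenvector test and resolvent bound -/

section Observability

open Matrix

variable {n k : Type*} [Fintype n] [DecidableEq n]

/-- The eigenvector test implies the Kalman test, relative to an invariant subspace. -/
theorem eq_zero_of_forall_vecMul_pow (A : Matrix n n ℂ) (B : Matrix n k ℂ)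
    (W : Submodule ℂ (n → ℂ)) (hW : ∀ v ∈ W, v ᵥ* A ∈ W)
    (h : ∀ (μ : ℂ), ∀ v ∈ W, v ᵥ* A = μ • v → v ᵥ* B = 0 → v = 0) :
    ∀ v ∈ W, (∀ j : ℕ, v ᵥ* (A ^ j * B) = 0) → v = 0 := by
  -- The unobservable vectors of `W` form an invariant subspace; if nonzero, it contains an
  -- eigenvector, which violates the test.
  let U : Submodule ℂ (n → ℂ) :=
    { carrier := {v | v ∈ W ∧ ∀ j : ℕ, v ᵥ* (A ^ j * B) = 0}
      add_mem' := fun ha hb => ⟨W.add_mem ha.1 hb.1, fun j => by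
        rw [add_vecMul, ha.2, hb.2, add_zero]⟩
      zero_mem' := ⟨W.zero_mem, fun j => zero_vecMul _⟩
      smul_mem' := fun c a ha => ⟨W.smul_mem c ha.1, fun j => by
        rw [smul_vecMul, ha.2, smul_zero]⟩ }
  have hU : ∀ v ∈ U, A.vecMulLinear v ∈ U := fun v hv => ⟨hW v hv.1, fun j => by
    change (v ᵥ* A) ᵥ* (A ^ j * B) = 0
    rw [vecMul_vecMul, ← Matrix.mul_assoc, ← pow_succ']
    exact hv.2 (j + 1)⟩
  intro v hv hv'
  by_contra hne
  have : Nontrivial U := ⟨⟨v, hv, hv'⟩, 0, fun h => hne (congrArg Subtype.val h)⟩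
  obtain ⟨μ, hμ⟩ := Module.End.exists_eigenvalue (A.vecMulLinear.restrict hU)
  obtain ⟨⟨x, hx⟩, hx1⟩ := hμ.exists_hasEigenvector
  refine hx1.2 (Subtype.ext (h μ x hx.1 (congrArg Subtype.val hx1.apply_eq_smul) ?_))
  simpa using hx.2 0

/-- For large `μ`, the resolvent row `e (μ - A)⁻¹` does not annihilate `B`, if some
`e A ^ j B` is nonzero. -/
theorem exists_bound_of_vecMul_pow_ne_zero [Fintype k] (A : Matrix n n ℂ) (B : Matrix n k ℂ) (e : n → ℂ)
    (he : ∃ j : ℕ, e ᵥ* (A ^ j * B) ≠ 0) :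
    ∃ r : ℝ, ∀ (μ : ℂ) (u : n → ℂ), r < ‖μ‖ → u ᵥ* A + e = μ • u → u ᵥ* B ≠ 0 := by
  classical
  obtain ⟨hj, hmin⟩ : e ᵥ* (A ^ (Nat.find he) * B) ≠ 0 ∧
      ∀ i < Nat.find he, e ᵥ* (A ^ i * B) = 0 :=
    ⟨Nat.find_spec he, fun i hi => not_not.mp (Nat.find_min he hi)⟩
  set j := Nat.find he
  set Φ := LinearMap.toContinuousLinearMap (A.vecMulLinear)
  set Ψ := LinearMap.toContinuousLinearMap ((A ^ (j + 1) * B).vecMulLinear)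
  set δ := ‖e ᵥ* (A ^ j * B)‖
  have hδ : 0 < δ := norm_pos_iff.mpr hj
  -- With `j` minimal, `u B = 0` propagates to `u A ^ i B = 0` for `i ≤ j`, and then `u A ^ (j + 1)
  -- B = -e A ^ j B` has norm `δ`. So `δ ≤ ‖Ψ‖ ‖u‖`, while `(‖μ‖ - ‖Φ‖) ‖u‖ ≤ ‖e‖`; the two clash
  -- beyond this radius.
  refine ⟨‖Φ‖ + ‖Ψ‖ * ‖e‖ / δ, fun μ u hμ hu hB => ?_⟩
  have hstep : ∀ i : ℕ, u ᵥ* (A ^ (i + 1) * B) = μ • (u ᵥ* (A ^ i * B)) - e ᵥ* (A ^ i * B) := by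
    intro i
    rw [pow_succ', Matrix.mul_assoc, ← vecMul_vecMul, eq_sub_of_add_eq hu, sub_vecMul, smul_vecMul]
  have hzero : ∀ i ≤ j, u ᵥ* (A ^ i * B) = 0 := by
    intro i
    induction i with
    | zero => intro _; simpa using hB
    | succ i ih =>
      intro hi
      rw [hstep, ih (by omega), hmin i (by omega)]
      simp
  have hΨ : ‖Ψ u‖ = δ := by
    change ‖u ᵥ* (A ^ (j + 1) * B)‖ = δ
    rw [hstep, hzero j le_rfl, smul_zero, zero_sub, norm_neg]
  have h1 : δ ≤ ‖Ψ‖ * ‖u‖ := hΨ ▸ Ψ.le_opNorm u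
  have h2 : ‖μ‖ * ‖u‖ ≤ ‖Φ‖ * ‖u‖ + ‖e‖ := by
    rw [← norm_smul, ← hu]
    exact (norm_add_le _ _).trans (add_le_add_left (Φ.le_opNorm u) _)
  have hu0 : 0 < ‖u‖ := by
    refine lt_of_le_of_ne (norm_nonneg _) fun h => ?_
    rw [← h, mul_zero] at h1
    exact absurd h1 (not_le.mpr hδ)
  have h3 : ‖Ψ‖ * ‖e‖ / δ * ‖u‖ < ‖e‖ := by nlinarith
  have h4 : ‖Ψ‖ * ‖u‖ * ‖e‖ < ‖e‖ * δ := by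
    have := mul_lt_mul_of_pos_right h3 hδ
    calc ‖Ψ‖ * ‖u‖ * ‖e‖ = ‖Ψ‖ * ‖e‖ / δ * ‖u‖ * δ := by field_simp
      _ < _ := this
  nlinarith [norm_nonneg e]

end Observability

/-! ### Sufficiency of the Kalman condition -/

section Steering

open Matrix NormedSpace

variable {d m : ℕ}

/-- The Kalman condition implies controllability. -/
theorem isControllable_of_kalman (A : Matrix (Fin d) (Fin d) ℝ) (B : Matrix (Fin d) (Fin m) ℝ)
    (h : ∀ v : Fin d → ℝ, (∀ j : ℕ, v ᵥ* (A ^ j * B) = 0) → v = 0) : IsControllable A B := by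
  intro x₀ x₁
  let Φ : (Fin d → ℝ) →L[ℝ] (Fin d → ℝ) := LinearMap.toContinuousLinearMap A.mulVecLin
  let β : (Fin m → ℝ) →L[ℝ] (Fin d → ℝ) := LinearMap.toContinuousLinearMap B.mulVecLin
  have hΦ : ∀ x, Φ x = A *ᵥ x := fun x => rfl
  have hβ : ∀ x, β x = B *ᵥ x := fun x => rfl
  let X : ℝ → (Fin d → ℝ) →L[ℝ] (Fin d → ℝ) := fun t => exp (t • Φ)
  have hX : ∀ t, HasDerivAt X (X t * Φ) t := fun t => hasDerivAt_exp_smul_const Φ t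
  have hX' : ∀ t, HasDerivAt X (Φ * X t) t := fun t => hasDerivAt_exp_smul_const' Φ t
  have hXc : Continuous X := continuous_iff_continuousAt.mpr fun t => (hX t).continuousAt
  have hX0 : X 0 = 1 := by simp [X]
  have hXinv : ∀ t, X t * X (-t) = 1 := fun t => by
    have hc : Commute (t • Φ) ((-t) • Φ) := (Commute.refl Φ).smul_left t |>.smul_right (-t)
    change exp _ * exp _ = _
    rw [← exp_add_of_commute_of_mem_ball (𝕂 := ℝ) hc (by simp [expSeries_radius_eq_top])
      (by simp [expSeries_radius_eq_top]), ← add_smul, add_neg_cancel, zero_smul, exp_zero]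
  have hg : ∀ u : C(ℝ, Fin m → ℝ), Continuous fun s => X (-s) (β (u s)) := fun u =>
    (hXc.comp continuous_neg).clm_apply (β.continuous.comp u.continuous)
  let S : C(ℝ, Fin m → ℝ) →ₗ[ℝ] (Fin d → ℝ) :=
    { toFun := fun u => ∫ s in (0 : ℝ)..1, X (-s) (β (u s))
      map_add' := fun u v => by
        rw [← intervalIntegral.integral_add ((hg u).intervalIntegrable _ _)
          ((hg v).intervalIntegrable _ _)]
        simp
      map_smul' := fun c u => by
        simp }
  have hS : LinearMap.range S = ⊤ := by
    by_contra hne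
    obtain ⟨φ, hφ0, hφ⟩ := Submodule.exists_le_ker_of_lt_top _ (lt_top_iff_ne_top.mpr hne)
    let φc := LinearMap.toContinuousLinearMap φ
    have hu : ∀ i : Fin m, Continuous fun s => φ (X (-s) (β (Pi.single i 1))) := fun i =>
      φc.continuous.comp ((hXc.comp continuous_neg).clm_apply continuous_const)
    -- This input turns `φ (S u) = 0` into the vanishing of an integral of squares.
    let u : C(ℝ, Fin m → ℝ) := ⟨fun s i => φ (X (-s) (β (Pi.single i 1))), continuous_pi hu⟩
    have hexp : ∀ s (w : Fin m → ℝ), φ (X (-s) (β w)) = ∑ i, w i * u s i := by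
      intro s w
      conv_lhs => rw [pi_eq_sum_univ' w]
      simp [u]
    have hint : ∫ s in (0 : ℝ)..1, ∑ i, u s i * u s i = 0 := by
      have h1 : φc (S u) = 0 := hφ (LinearMap.mem_range_self S u)
      have h2 := φc.intervalIntegral_comp_comm
        ((hg u).intervalIntegrable (μ := MeasureTheory.volume) 0 1)
      change _ = φc (S u) at h2
      refine Eq.trans ?_ (h2.trans h1)
      exact intervalIntegral.integral_congr fun s _ => (hexp s (u s)).symm
    have hcont : Continuous fun s => ∑ i, u s i * u s i :=
      continuous_finsetSum _ fun i _ => (hu i).mul (hu i)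
    have hzero : ∀ s ∈ Set.Ioo (0 : ℝ) 1, ∀ w, φ (X (-s) (β w)) = 0 := by
      intro s hs w
      have hs0 : ∑ i, u s i * u s i = 0 := by
        by_contra hs0
        refine absurd hint (ne_of_gt (intervalIntegral.integral_pos zero_lt_one
          hcont.continuousOn (fun t _ => Finset.sum_nonneg fun i _ => mul_self_nonneg _)
          ⟨s, Set.Ioo_subset_Icc_self hs, ?_⟩))
        exact lt_of_le_of_ne (Finset.sum_nonneg fun i _ => mul_self_nonneg _) (Ne.symm hs0)
      rw [Finset.sum_eq_zero_iff_of_nonneg fun i _ => mul_self_nonneg _] at hs0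
      rw [hexp]
      exact Finset.sum_eq_zero fun i hi => by rw [mul_self_eq_zero.mp (hs0 i hi), mul_zero]
    -- Each derivative in `s` brings down one factor `-Φ`.
    have hpow : ∀ j : ℕ, ∀ s ∈ Set.Ioo (0 : ℝ) 1, ∀ w, φ (X (-s) ((Φ ^ j) (β w))) = 0 := by
      intro j
      induction j with
      | zero => simpa using hzero
      | succ j ih =>
        intro s hs w
        have hd : HasDerivAt (fun s => φ (X (-s) ((Φ ^ j) (β w))))
            (φ ((-(X (-s) * Φ)) ((Φ ^ j) (β w)))) s := by
          have h1 : HasDerivAt (fun s => X (-s)) (-(X (-s) * Φ)) s := by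
            have := (hX (-s)).scomp s (hasDerivAt_neg s)
            rw [neg_one_smul] at this
            exact this
          have h2 := h1.clm_apply (hasDerivAt_const s ((Φ ^ j) (β w)))
          rw [map_zero, add_zero] at h2
          exact φc.hasFDerivAt.comp_hasDerivAt s h2
        have h0 : HasDerivAt (fun s => φ (X (-s) ((Φ ^ j) (β w)))) 0 s :=
          (hasDerivAt_const s (0 : ℝ)).congr_of_eventuallyEq
            (Filter.eventually_of_mem (isOpen_Ioo.mem_nhds hs) fun t ht => ih t ht w)
        have := hd.unique h0
        rw [_root_.neg_apply, map_neg, neg_eq_zero] at this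
        rw [pow_succ']
        exact this
    have hpow' : ∀ (j : ℕ) (x : Fin d → ℝ), (Φ ^ j) x = (A ^ j) *ᵥ x := by
      intro j
      induction j with
      | zero => simp
      | succ j ih =>
        intro x
        rw [pow_succ', pow_succ', ← mulVec_mulVec, ← ih]
        rfl
    let ψ : (Fin d → ℝ) →ₗ[ℝ] ℝ := φ ∘ₗ (X (-(1 / 2)) : (Fin d → ℝ) →ₗ[ℝ] (Fin d → ℝ))
    have hψ : ∀ x, ψ x = (fun i => ψ (Pi.single i 1)) ⬝ᵥ x := by
      intro x
      conv_lhs => rw [pi_eq_sum_univ' x]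
      simp only [map_sum, map_smul, smul_eq_mul, dotProduct]
      exact Finset.sum_congr rfl fun i _ => mul_comm _ _
    have hψ0 : ∀ x, ψ x = 0 := by
      have := h (fun i => ψ (Pi.single i 1)) fun j => by
        refine dotProduct_eq_zero _ fun w => ?_
        rw [← dotProduct_mulVec, ← mulVec_mulVec, ← hψ, ← hpow']
        exact hpow j (1 / 2) (by norm_num) w
      intro x
      rw [hψ, this, zero_dotProduct]
    refine hφ0 (LinearMap.ext fun x => ?_)
    have hx : X (-(1 / 2)) (X (1 / 2) x) = x := by
      have := hXinv (-(1 / 2))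
      rw [neg_neg] at this
      exact congrArg (fun F : (Fin d → ℝ) →L[ℝ] (Fin d → ℝ) => F x) this
    have := hψ0 (X (1 / 2) x)
    change φ (X (-(1 / 2)) (X (1 / 2) x)) = 0 at this
    rwa [hx] at this
  -- Variation of constants: the state at time `1` is `X 1 (x₀ + S u)`.
  obtain ⟨u, hu⟩ : ∃ u, S u = X (-1) x₁ - x₀ := LinearMap.range_eq_top.mp hS _
  have hu' : ∫ s in (0 : ℝ)..1, X (-s) (β (u s)) = X (-1) x₁ - x₀ := hu
  refine ⟨1, one_pos, u, fun t => X t (x₀ + ∫ s in (0 : ℝ)..t, X (-s) (β (u s))),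
    u.continuous.continuousOn, fun t _ => ?_, ?_, ?_⟩
  · have h1 : HasDerivAt (fun t => x₀ + ∫ s in (0 : ℝ)..t, X (-s) (β (u s)))
        (X (-t) (β (u t))) t :=
      (intervalIntegral.integral_hasDerivAt_right ((hg u).intervalIntegrable _ _)
        ((hg u).stronglyMeasurableAtFilter _ _) (hg u).continuousAt).const_add x₀
    have h2 := ((hX' t).clm_apply h1).hasDerivWithinAt (s := Set.Icc 0 1)
    have h3 : X t (X (-t) (β (u t))) = B *ᵥ u t :=
      congrArg (fun F : (Fin d → ℝ) →L[ℝ] (Fin d → ℝ) => F (β (u t))) (hXinv t)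
    rw [h3] at h2
    exact h2
  · simp [hX0]
  · simp only [hu', add_sub_cancel]
    exact congrArg (fun F : (Fin d → ℝ) →L[ℝ] (Fin d → ℝ) => F x₁) (hXinv 1)

/-- The eigenvector test over `ℂ` implies controllability. -/
theorem isControllable_of_eigenvector (A : Matrix (Fin d) (Fin d) ℝ)
    (B : Matrix (Fin d) (Fin m) ℝ)
    (h : ∀ (μ : ℂ) (v : Fin d → ℂ), v ᵥ* A.map Complex.ofRealHom = μ • v →
      v ᵥ* B.map Complex.ofRealHom = 0 → v = 0) : IsControllable A B := by
  refine isControllable_of_kalman A B fun v hv => ?_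
  have := eq_zero_of_forall_vecMul_pow (A.map Complex.ofRealHom) (B.map Complex.ofRealHom) ⊤
    (fun _ _ => trivial) (fun μ v _ => h μ v) (Complex.ofRealHom ∘ v) trivial fun j => by
      rw [← Matrix.map_pow, ← Matrix.map_mul]
      funext i
      rw [← RingHom.map_vecMul, hv j]
      simp
  funext i
  simpa using congrFun this i

end Steering

end StructuralControl

/-! ### Controllable realisation from a saturating matching -/

namespace StructuralControl

open Matrix

variable {d m : ℕ}

theorem vecMul_apply_eq_sum {n k R : Type*} [Fintype n] [NonUnitalNonAssocSemiring R] (v : n → R)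
    (A : Matrix n k R) (j : k) : (v ᵥ* A) j = ∑ i, v i * A i j := rfl

/-- The input matrix with entry `1` at `(i, k)` if `f i` is the `k`-th input. -/
def inputOf (f : Fin d → Fin d ⊕ Fin m) : Matrix (Fin d) (Fin m) ℝ :=
  fun i k => if f i = Sum.inr k then 1 else 0

/-- A realisation of `A` that lives on the vertex set `S` and passes, for vectors supported on `S`,
the eigenvector test with the inputs prescribed by `f`. -/
def ControllableOn (A : SparsityMatrix d d) (f : Fin d → Fin d ⊕ Fin m) (S : Finset (Fin d)) :
    Prop :=
  ∃ A' : Matrix (Fin d) (Fin d) ℝ, IsRealisation A A' ∧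
    (∀ i j, ¬ (i ∈ S ∧ j ∈ S) → A' i j = 0) ∧
    ∀ (μ : ℂ) (v : Fin d → ℂ), (∀ i ∉ S, v i = 0) →
      v ᵥ* A'.map Complex.ofRealHom = μ • v →
      v ᵥ* (inputOf f).map Complex.ofRealHom = 0 → v = 0

/-- The vertices on the paths that start at the inputs. -/
inductive IsStem (f : Fin d → Fin d ⊕ Fin m) : Fin d → Prop
  | root {i : Fin d} {k : Fin m} (h : f i = Sum.inr k) : IsStem f i
  | step {i j : Fin d} (h : f i = Sum.inl j) (hj : IsStem f j) : IsStem f i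

/-- Weight `1` on every path edge works. As `f` is injective, each relevant column has a single
nonzero entry, so the zero forced at a root by its input travels along the path, whatever `μ` is. -/
theorem controllableOn_stems {A : SparsityMatrix d d} {f : Fin d → Fin d ⊕ Fin m}
    (hf : Function.Injective f) (hA : ∀ i j, f i = Sum.inl j → A i j = true)
    {S : Finset (Fin d)} (hS : ∀ i, i ∈ S ↔ IsStem f i) : ControllableOn A f S := by
  refine ⟨Matrix.of fun i j => if i ∈ S ∧ j ∈ S ∧ f i = Sum.inl j then 1 else 0, ?_, ?_, ?_⟩
  · intro i j hij
    rw [of_apply, if_neg]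
    rintro ⟨-, -, h⟩
    rw [hA i j h] at hij
    exact absurd hij (by decide)
  · intro i j hij
    rw [of_apply, if_neg]
    exact fun h => hij ⟨h.1, h.2.1⟩
  · intro μ v hv hvA hvB
    suffices h : ∀ i, IsStem f i → v i = 0 by
      funext i
      by_cases hi : i ∈ S
      · exact h i ((hS i).mp hi)
      · exact hv i hi
    intro i hi
    induction hi with
    | @root i k h =>
      have := congrFun hvB k
      simp only [vecMul, dotProduct, Pi.zero_apply] at this
      rw [Finset.sum_eq_single i] at this
      · simpa [inputOf, h] using this
      · intro b _ hb
        have : f b ≠ Sum.inr k := fun h' => hb (hf (h'.trans h.symm))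
        simp [inputOf, this]
      · simp
    | @step i j h hj ih =>
      have := congrFun hvA j
      simp only [vecMul, dotProduct, Pi.smul_apply, ih, smul_zero] at this
      rw [Finset.sum_eq_single i] at this
      · have hiS : i ∈ S := (hS i).mpr (.step h hj)
        simpa [h, hiS, (hS j).mpr hj] using this
      · intro b _ hb
        have : f b ≠ Sum.inl j := fun h' => hb (hf (h'.trans h.symm))
        simp [this]
      · simp

/-- The set `S` is closed under predecessors and successors along `f`, and contains the vertices
fed by an input. -/
def IsClosedUnder (f : Fin d → Fin d ⊕ Fin m) (S : Finset (Fin d)) : Prop :=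
  (∀ i j, f i = Sum.inl j → (i ∈ S ↔ j ∈ S)) ∧ ∀ i k, f i = Sum.inr k → i ∈ S

/-- A cycle of `f` disjoint from `S` can be attached to `S` along an edge from `S`. -/
theorem ControllableOn.union_cycle {A : SparsityMatrix d d} {f : Fin d → Fin d ⊕ Fin m}
    (hf : Function.Injective f) (hA : ∀ i j, f i = Sum.inl j → A i j = true)
    {S C : Finset (Fin d)} (hS : ControllableOn A f S)
    {p q : Fin d} (hp : p ∈ S) (hpq : A q p = true) (hdisj : Disjoint S C)
    (σ : Fin d → Fin d) (hσ : ∀ i ∈ C, f i = Sum.inl (σ i))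
    (hC : ∀ i, i ∈ C ↔ ∃ k : ℕ, σ^[k] q = i)
    {n : ℕ} (hn : 0 < n) (hper : σ^[n] q = q) : ControllableOn A f (S ∪ C) := by
  obtain ⟨A₀, hreal, hsupp, hpbh⟩ := hS
  set Ac := A₀.map Complex.ofRealHom with hAc
  set Bc := (inputOf f).map Complex.ofRealHom with hBc
  have hAc0 : ∀ i j, ¬ (i ∈ S ∧ j ∈ S) → Ac i j = 0 := fun i j h => by
    rw [hAc, map_apply, hsupp i j h, map_zero]
  have hnS : ∀ i ∈ C, i ∉ S := fun i hi h => Finset.disjoint_left.mp hdisj h hi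
  have hqC : q ∈ C := (hC q).mpr ⟨0, rfl⟩
  have hσC : ∀ i ∈ C, σ i ∈ C := fun i hi => by
    obtain ⟨k, rfl⟩ := (hC i).mp hi
    exact (hC _).mpr ⟨k + 1, Function.iterate_succ_apply' σ k q⟩
  have hσinj : ∀ i ∈ C, ∀ j ∈ C, σ i = σ j → i = j := fun i hi j hj h =>
    hf (by rw [hσ i hi, hσ j hj, h])
  have hBC : ∀ i ∈ C, ∀ k, Bc i k = 0 := fun i hi k => by
    simp [hBc, inputOf, hσ i hi]
  -- the row `e_p` is observed by the inputs of the system on `S`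
  have hobs : ∃ j : ℕ, (Pi.single p 1 : Fin d → ℂ) ᵥ* (Ac ^ j * Bc) ≠ 0 := by
    by_contra hcon
    push Not at hcon
    let W : Submodule ℂ (Fin d → ℂ) :=
      { carrier := {v | ∀ i ∉ S, v i = 0}
        add_mem' := fun ha hb i hi => by simp [ha i hi, hb i hi]
        zero_mem' := fun i _ => rfl
        smul_mem' := fun c a ha i hi => by simp [ha i hi] }
    have := eq_zero_of_forall_vecMul_pow Ac Bc W
      (fun v _ i hi => Finset.sum_eq_zero fun j _ => by
        change v j * Ac j i = 0
        rw [hAc0 j i fun h => hi h.2, mul_zero])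
      (fun μ v hv => hpbh μ v hv) (Pi.single p 1)
      (fun i hi => Pi.single_eq_of_ne (fun h : i = p => hi (h ▸ hp)) _) hcon
    simpa using congrFun this p
  obtain ⟨r, hr⟩ := exists_bound_of_vecMul_pow_ne_zero Ac Bc _ hobs
  -- `c` is the weight of every cycle edge. It forces `‖μ‖ = c` for a mode not vanishing at `q`,
  -- beyond the resolvent bound `r`.
  obtain ⟨c, hc0, hcr⟩ : ∃ c : ℝ, 0 < c ∧ r < c :=
    ⟨max r 0 + 1, by positivity, (le_max_left r 0).trans_lt (lt_add_one _)⟩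
  refine ⟨Matrix.of fun i j => A₀ i j + (if i = q ∧ j = p then 1 else 0) +
    (if i ∈ C ∧ σ i = j then c else 0), ?_, ?_, ?_⟩
  · intro i j hij
    have hij' : A i j ≠ true := by rw [hij]; decide
    rw [of_apply, hreal i j hij, if_neg, if_neg]
    · simp
    · rintro ⟨hi, rfl⟩
      exact hij' (hA _ _ (hσ i hi))
    · rintro ⟨rfl, rfl⟩
      exact hij' hpq
  · intro i j hij
    rw [of_apply, hsupp, if_neg, if_neg]
    · simp
    · rintro ⟨hi, rfl⟩
      exact hij ⟨Finset.mem_union_right _ hi, Finset.mem_union_right _ (hσC i hi)⟩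
    · rintro ⟨rfl, rfl⟩
      exact hij ⟨Finset.mem_union_right _ hqC, Finset.mem_union_left _ hp⟩
    · exact fun h => hij ⟨Finset.mem_union_left _ h.1, Finset.mem_union_left _ h.2⟩
  · intro μ v hv hvA hvB
    rw [← hBc] at hvB
    have hcol : ∀ j, (v ᵥ* Ac) j + (if j = p then v q else 0) +
        (∑ i, if i ∈ C ∧ σ i = j then v i * c else 0) = μ * v j := by
      intro j
      have h1 : (∑ i, if i = q ∧ j = p then v i else 0) = if j = p then v q else 0 := by
        by_cases h : j = p <;> simp [h]
      rw [← h1]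
      have h2 := congrFun hvA j
      simp only [vecMul, dotProduct, Pi.smul_apply, smul_eq_mul] at h2 ⊢
      rw [← h2, ← Finset.sum_add_distrib, ← Finset.sum_add_distrib]
      refine Finset.sum_congr rfl fun i _ => ?_
      simp only [map_apply, of_apply, map_add, mul_add, hAc]
      congr 1
      · congr 1
        split_ifs <;> simp
      · split_ifs <;> simp
    have hcyc : ∀ i ∈ C, v i * c = μ * v (σ i) := by
      intro i hi
      have h1 : (v ᵥ* Ac) (σ i) = 0 := by
        refine (vecMul_apply_eq_sum v Ac _).trans (Finset.sum_eq_zero fun b _ => ?_)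
        rw [hAc0 b (σ i) fun h => hnS _ (hσC i hi) h.2, mul_zero]
      have h2 : σ i ≠ p := fun h => hnS _ (hσC i hi) (h ▸ hp)
      have h3 := hcol (σ i)
      rw [h1, if_neg h2, Finset.sum_eq_single i] at h3
      · simpa [hi] using h3
      · intro b _ hb
        exact if_neg fun h => hb (hσinj b h.1 i hi h.2)
      · simp
    -- On `S` the cycle is felt only through the edge from `p` to `q`, as the forcing term `v q •
    -- e_p`.
    set u : Fin d → ℂ := fun i => if i ∈ S then v i else 0 with hu
    have huA : u ᵥ* Ac = v ᵥ* Ac := by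
      funext j
      rw [vecMul_apply_eq_sum, vecMul_apply_eq_sum]
      refine Finset.sum_congr rfl fun i _ => ?_
      by_cases hi : i ∈ S
      · simp [hu, hi]
      · rw [hAc0 i j fun h => hi h.1, mul_zero, mul_zero]
    have huB : u ᵥ* Bc = 0 := by
      rw [← hvB]
      funext k
      rw [vecMul_apply_eq_sum, vecMul_apply_eq_sum]
      refine Finset.sum_congr rfl fun i _ => ?_
      by_cases hi : i ∈ S
      · simp [hu, hi]
      · by_cases hiC : i ∈ C
        · rw [hBC i hiC, mul_zero, mul_zero]
        · have : v i = 0 := hv i (by simp [hi, hiC])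
          simp [hu, hi, this]
    have hueq : u ᵥ* Ac + (v q) • Pi.single p 1 = μ • u := by
      funext j
      rw [huA]
      by_cases hj : j ∈ S
      · have h3 := hcol j
        have h4 : (∑ i, if i ∈ C ∧ σ i = j then v i * c else 0) = 0 :=
          Finset.sum_eq_zero fun i _ => if_neg fun h : i ∈ C ∧ σ i = j =>
            hnS _ (hσC i h.1) (h.2 ▸ hj)
        rw [h4, add_zero] at h3
        simp only [Pi.add_apply, Pi.smul_apply, smul_eq_mul, Pi.single_apply, hu, hj, if_true,
          mul_ite, mul_one, mul_zero]
        exact h3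
      · have h1 : (v ᵥ* Ac) j = 0 := by
          refine (vecMul_apply_eq_sum v Ac _).trans (Finset.sum_eq_zero fun b _ => ?_)
          rw [hAc0 b j fun h => hj h.2, mul_zero]
        have h2 : j ≠ p := fun h => hj (h ▸ hp)
        simp [h1, h2, hu, hj]
    have hcne : (c : ℂ) ≠ 0 := Complex.ofReal_ne_zero.mpr hc0.ne'
    -- If `v q = 0`, the cycle relations kill `v` on `C` and the test on `S` applies. Otherwise
    -- going once round gives `c ^ n = μ ^ n`, and `u / v q` contradicts the resolvent bound.
    by_cases hvq : v q = 0
    · have hvC : ∀ i ∈ C, v i = 0 := by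
        intro i hi
        by_cases hμ : μ = 0
        · have := hcyc i hi
          rw [hμ, zero_mul] at this
          exact (mul_eq_zero.mp this).resolve_right hcne
        · obtain ⟨k, rfl⟩ := (hC i).mp hi
          clear hi
          induction k with
          | zero => exact hvq
          | succ k ih =>
            have := hcyc _ ((hC _).mpr ⟨k, rfl⟩)
            rw [ih, zero_mul] at this
            rw [Function.iterate_succ_apply']
            exact (mul_eq_zero.mp this.symm).resolve_left hμ
      have huv : u = v := by
        funext i
        by_cases hi : i ∈ S
        · simp [hu, hi]
        · by_cases hiC : i ∈ C
          · simp [hu, hi, hvC i hiC]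
          · simp [hu, hi, hv i (by simp [hi, hiC])]
      rw [← huv]
      refine hpbh μ u (fun i hi => by simp [hu, hi]) ?_ huB
      rw [← hueq, hvq, zero_smul, add_zero]
    · exfalso
      have hpow : ∀ k : ℕ, v q * (c : ℂ) ^ k = μ ^ k * v (σ^[k] q) := by
        intro k
        induction k with
        | zero => simp
        | succ k ih =>
          rw [pow_succ, ← mul_assoc, ih, mul_assoc, hcyc _ ((hC _).mpr ⟨k, rfl⟩),
            Function.iterate_succ_apply', pow_succ, mul_assoc]
      have hμ : ‖μ‖ = c := by
        have h1 := hpow n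
        rw [hper, mul_comm] at h1
        have h2 := congrArg norm (mul_right_cancel₀ hvq h1)
        rw [norm_pow, norm_pow, Complex.norm_real, Real.norm_of_nonneg hc0.le] at h2
        exact ((pow_left_inj₀ hc0.le (norm_nonneg μ) hn.ne').mp h2).symm
      refine hr μ ((v q)⁻¹ • u) (hμ ▸ hcr) ?_ (by rw [smul_vecMul, huB, smul_zero])
      rw [smul_vecMul, smul_comm μ, ← hueq, smul_add, inv_smul_smul₀ hvq]

/-- The orbit repeats by finiteness, and injectivity of `f` cancels steps until the repetition
occurs at `q`. -/
theorem exists_iterate_eq_self {f : Fin d → Fin d ⊕ Fin m} (hf : Function.Injective f)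
    (σ : Fin d → Fin d) (q : Fin d) (hσ : ∀ k : ℕ, f (σ^[k] q) = Sum.inl (σ (σ^[k] q))) :
    ∃ n : ℕ, 0 < n ∧ σ^[n] q = q := by
  have hcancel : ∀ a n : ℕ, σ^[a + n] q = σ^[a] q → σ^[n] q = q := by
    intro a
    induction a with
    | zero => intro n h; simpa using h
    | succ a ih =>
      intro n h
      refine ih n (hf ?_)
      rw [hσ, hσ, ← Function.iterate_succ_apply' σ, ← Function.iterate_succ_apply' σ, ← h]
      congr 2
      omega
  obtain ⟨a, b, hab, h⟩ := Finite.exists_ne_map_eq_of_infinite fun k : ℕ => σ^[k] q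
  rcases lt_or_gt_of_ne hab with h' | h'
  · exact ⟨b - a, by omega, hcancel a _ (by rw [Nat.add_sub_cancel' h'.le]; exact h.symm)⟩
  · exact ⟨a - b, by omega, hcancel b _ (by rw [Nat.add_sub_cancel' h'.le]; exact h)⟩

/-- In a strongly connected digraph, an edge leaves every nonempty proper vertex set. -/
theorem IsStronglyConnected.exists_adj {V : Type*} {G : Digraph V} (hG : IsStronglyConnected G)
    (S : Set V) {a b : V} (ha : a ∈ S) (hb : b ∉ S) : ∃ p ∈ S, ∃ q ∉ S, G.Adj p q := by
  by_contra hcon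
  push Not at hcon
  have key : ∀ c, Relation.ReflTransGen G.Adj a c → c ∈ S := fun c hc => by
    induction hc with
    | refl => exact ha
    | @tail x y _ hxy ih =>
      by_contra hy
      exact hcon x ih y hy hxy
  exact hb (key b (hG a b))

/-- An edge leaves `S` at some `q`. Since `S` is closed and contains all input-fed vertices, the
predecessors of `q` under `f` never enter `S`, so they form a cycle that can be attached. -/
theorem ControllableOn.exists_larger {A : SparsityMatrix d d} {f : Fin d → Fin d ⊕ Fin m}
    (hf : Function.Injective f) (hA : ∀ i j, f i = Sum.inl j → A i j = true)
    (hconn : IsStronglyConnected (stateDigraph A)) {S : Finset (Fin d)}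
    (hcl : IsClosedUnder f S) (hne : S.Nonempty) (hS : ControllableOn A f S)
    (huniv : S ≠ Finset.univ) :
    ∃ T, S ⊂ T ∧ IsClosedUnder f T ∧ ControllableOn A f T := by
  classical
  obtain ⟨b, hb⟩ : ∃ b, b ∉ S := by
    by_contra h
    push Not at h
    exact huniv (Finset.eq_univ_iff_forall.mpr h)
  obtain ⟨a, ha⟩ := hne
  obtain ⟨p, hp, q, hq, hpq⟩ := hconn.exists_adj (S : Set (Fin d)) ha hb
  -- The implication sits inside the existential so that `σ` is a total function; where `f i` is an
  -- input its value is arbitrary.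
  have hpred : ∀ i, ∃ j, i ∉ S → f i = Sum.inl j := by
    intro i
    rcases hfi : f i with j | k
    · exact ⟨j, fun _ => rfl⟩
    · exact ⟨i, fun h => absurd (hcl.2 i k hfi) h⟩
  choose σ hσ using hpred
  have horb : ∀ k : ℕ, σ^[k] q ∉ S := by
    intro k
    induction k with
    | zero => exact hq
    | succ k ih =>
      rw [Function.iterate_succ_apply']
      exact fun h => ih ((hcl.1 _ _ (hσ _ ih)).mpr h)
  obtain ⟨n, hn, hper⟩ := exists_iterate_eq_self hf σ q fun k => hσ _ (horb k)
  let C : Finset (Fin d) := Finset.univ.filter fun i => ∃ k : ℕ, σ^[k] q = i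
  have hC : ∀ i, i ∈ C ↔ ∃ k : ℕ, σ^[k] q = i := fun i => by simp [C]
  have hCS : ∀ i ∈ C, i ∉ S := fun i hi => by
    obtain ⟨k, rfl⟩ := (hC i).mp hi
    exact horb k
  have hσC : ∀ i ∈ C, σ i ∈ C := fun i hi => by
    obtain ⟨k, rfl⟩ := (hC i).mp hi
    exact (hC _).mpr ⟨k + 1, Function.iterate_succ_apply' σ k q⟩
  have hqC : q ∈ C := (hC q).mpr ⟨0, rfl⟩
  have hpre : ∀ j ∈ C, ∃ i ∈ C, σ i = j := by
    intro j hj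
    obtain ⟨k, rfl⟩ := (hC j).mp hj
    rcases k with _ | k
    · refine ⟨σ^[n - 1] q, (hC _).mpr ⟨_, rfl⟩, ?_⟩
      rw [← Function.iterate_succ_apply' σ, Nat.succ_eq_add_one, Nat.sub_add_cancel hn]
      exact hper
    · exact ⟨σ^[k] q, (hC _).mpr ⟨_, rfl⟩, (Function.iterate_succ_apply' σ k q).symm⟩
  refine ⟨S ∪ C, ?_, ⟨fun i j hij => ?_, fun i k h => Finset.mem_union_left _ (hcl.2 i k h)⟩,
    hS.union_cycle hf hA hp hpq (Finset.disjoint_right.mpr hCS) σ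
      (fun i hi => hσ i (hCS i hi)) hC hn hper⟩
  · exact Finset.ssubset_iff_subset_ne.mpr ⟨Finset.subset_union_left, fun h =>
      hCS q hqC (h ▸ Finset.mem_union_right _ hqC)⟩
  · rw [Finset.mem_union, Finset.mem_union, hcl.1 i j hij]
    refine or_congr_right' fun hj => ⟨fun hi => ?_, fun hjC => ?_⟩
    · have := hσC i hi
      rwa [Sum.inl.inj ((hσ i (hCS i hi)).symm.trans hij)] at this
    · obtain ⟨i', hi', rfl⟩ := hpre j hjC
      rwa [hf (hij.trans (hσ i' (hCS i' hi')).symm)]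

/-- Start from the stems, nonempty because some vertex is fed by an input; a maximal closed
controllable set above them must be everything. -/
theorem controllableOn_univ {A : SparsityMatrix d d} {f : Fin d → Fin d ⊕ Fin m}
    (hf : Function.Injective f) (hA : ∀ i j, f i = Sum.inl j → A i j = true)
    (hconn : IsStronglyConnected (stateDigraph A)) (hin : ∃ i k, f i = Sum.inr k) :
    ControllableOn A f Finset.univ := by
  classical
  let S₀ : Finset (Fin d) := Finset.univ.filter (IsStem f)
  have hS₀ : ∀ i, i ∈ S₀ ↔ IsStem f i := fun i => by simp [S₀]
  let P : Finset (Fin d) → Prop := fun S =>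
    S.Nonempty ∧ IsClosedUnder f S ∧ ControllableOn A f S
  have h0 : P S₀ := by
    refine ⟨?_, ⟨fun i j hij => ?_, fun i k h => (hS₀ i).mpr (.root h)⟩,
      controllableOn_stems hf hA hS₀⟩
    · obtain ⟨i, k, h⟩ := hin
      exact ⟨i, (hS₀ i).mpr (.root h)⟩
    · rw [hS₀, hS₀]
      refine ⟨fun h => ?_, .step hij⟩
      cases h with
      | root h => rw [h] at hij; exact absurd hij (by simp)
      | step h hj => rwa [← Sum.inl.inj (h.symm.trans hij)]
  obtain ⟨S, -, hS⟩ := Set.Finite.exists_le_maximal (Set.toFinite {S | P S}) h0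
  by_contra hcon
  have huniv : S ≠ Finset.univ := fun h => hcon (h ▸ hS.prop.2.2)
  obtain ⟨T, hST, hcl, hT⟩ := hS.prop.2.2.exists_larger hf hA hconn hS.prop.2.1 hS.prop.1 huniv
  exact hST.2 (hS.2 (show P T from ⟨hS.prop.1.mono hST.1, hcl, hT⟩) hST.1)

/-- A saturating matching with at least one input edge yields a structurally controllable pair,
if the state digraph is strongly connected. -/
theorem isStructurallyControllable_of_matching {A : SparsityMatrix d d} {B : SparsityMatrix d m}
    (hconn : IsStronglyConnected (stateDigraph A)) (f : Fin d → Fin d ⊕ Fin m)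
    (hf : Function.Injective f) (hA : ∀ i j, f i = Sum.inl j → A i j = true)
    (hB : ∀ i k, f i = Sum.inr k → B i k = true) (hin : ∃ i k, f i = Sum.inr k) :
    IsStructurallyControllable A B := by
  obtain ⟨A', hreal, -, hpbh⟩ := controllableOn_univ hf hA hconn hin
  refine ⟨A', inputOf f, hreal, fun i k h => if_neg fun h' => ?_,
    isControllable_of_eigenvector _ _ fun μ v => hpbh μ v (by simp)⟩
  rw [hB i k h'] at h
  exact absurd h (by decide)

end StructuralControl

/-! ### Matchings versus input matrices: cost and cardinality -/

namespace StructuralControl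

variable {d m : ℕ}

theorem mem_systemEdges_inl {A : SparsityMatrix d d} {B : SparsityMatrix d m} {i j : Fin d} :
    (Sum.inl j, i) ∈ systemEdges A B ↔ A i j = true := by
  simp [systemEdges]

theorem mem_systemEdges_inr {A : SparsityMatrix d d} {B : SparsityMatrix d m} {i : Fin d}
    {k : Fin m} : (Sum.inr k, i) ∈ systemEdges A B ↔ B i k = true := by
  simp [systemEdges]

theorem mem_statePart {M : Finset ((Fin d ⊕ Fin m) × Fin d)} {e : Fin d × Fin d} :
    e ∈ statePart M ↔ (Sum.inl e.1, e.2) ∈ M := by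
  simp [statePart]

theorem inputMatrixOf_eq_true {M : Finset ((Fin d ⊕ Fin m) × Fin d)} {i : Fin d} {k : Fin m} :
    inputMatrixOf M i k = true ↔ (Sum.inr k, i) ∈ M := by
  simp [inputMatrixOf]

theorem weight_inputMatrixOf (w : Matrix (Fin d) (Fin m) ℝ)
    (M : Finset ((Fin d ⊕ Fin m) × Fin d)) :
    weight w (inputMatrixOf M) = ∑ e ∈ M, edgeCost w e := by
  classical
  have h : ∑ e ∈ M, edgeCost w e = ∑ e, if e ∈ M then edgeCost w e else 0 := by
    rw [← Finset.sum_filter]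
    simp
  rw [h, Fintype.sum_prod_type_right]
  refine Finset.sum_congr rfl fun i _ => ?_
  rw [Fintype.sum_sum_type]
  simp [edgeCost, inputMatrixOf]

/-- Among matchings of size `d`, this makes few input entries the same as many state edges. -/
theorem card_eq_nnz_add_card_statePart (M : Finset ((Fin d ⊕ Fin m) × Fin d)) :
    M.card = nnz (inputMatrixOf M) + (statePart M).card := by
  classical
  have h1 : M.card = ∑ e, if e ∈ M then 1 else 0 := by simp
  have h2 : nnz (inputMatrixOf M)
      = ∑ p : Fin d × Fin m, if (Sum.inr p.2, p.1) ∈ M then 1 else 0 := by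
    simp [nnz, inputMatrixOf]
  have h3 : (statePart M).card = ∑ p : Fin d × Fin d, if (Sum.inl p.1, p.2) ∈ M then 1 else 0 := by
    simp [statePart]
  rw [h1, h2, h3, Fintype.sum_prod_type_right, Fintype.sum_prod_type, Fintype.sum_prod_type_right,
    ← Finset.sum_add_distrib]
  refine Finset.sum_congr rfl fun i _ => ?_
  rw [Fintype.sum_sum_type, add_comm]

theorem isMatching_statePart {A : SparsityMatrix d d} {B : SparsityMatrix d m}
    {M : Finset ((Fin d ⊕ Fin m) × Fin d)} (hM : IsMatching (systemEdges A B) M) :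
    IsMatching (stateEdges A) (statePart M) := by
  refine ⟨fun e he => ?_, fun a ha b hb hab => ?_⟩
  · simpa [stateEdges, mem_systemEdges_inl] using hM.1 (mem_statePart.mp he)
  · have := hM.2 _ (mem_statePart.mp ha) _ (mem_statePart.mp hb) fun h =>
      hab (Prod.ext (Sum.inl.inj (Prod.mk.inj h).1) (Prod.mk.inj h).2)
    exact ⟨fun h => this.1 (by rw [h]), this.2⟩

theorem weight_mono {w : Matrix (Fin d) (Fin m) ℝ} {N N' : SparsityMatrix d m}
    (h : ∀ i k, N i k = true → N' i k = true) (hw : ∀ i k, N' i k = true → 0 ≤ w i k) :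
    weight w N ≤ weight w N' := by
  refine Finset.sum_le_sum fun i _ => Finset.sum_le_sum fun k _ => ?_
  by_cases h1 : N i k = true
  · simp [h1, h i k h1]
  · by_cases h2 : N' i k = true
    · simp [h1, h2, hw i k h2]
    · simp [h1, h2]

theorem nnz_mono {N N' : SparsityMatrix d m} (h : ∀ i k, N i k = true → N' i k = true) :
    nnz N ≤ nnz N' :=
  Finset.card_le_card fun p hp => by
    simp only [Finset.mem_filter, Finset.mem_univ, true_and] at hp ⊢
    exact h _ _ hp

/-- The state part of a cheapest saturating matching is a maximum matching of `Γ(A)`. -/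
theorem isMaximumMatching_statePart {A : SparsityMatrix d d} {B : SparsityMatrix d m}
    {w : Matrix (Fin d) (Fin m) ℝ} (hpos : ∀ i j, B i j = true → 0 < w i j)
    {M : Finset ((Fin d ⊕ Fin m) × Fin d)}
    (hM : IsMinCostMaximumMatching (systemEdges A B) (edgeCost w) M) (hcard : M.card = d) :
    IsMaximumMatching (stateEdges A) (statePart M) := by
  classical
  have hMm := hM.1.1
  refine ⟨isMatching_statePart hMm, fun N hN => ?_⟩
  by_contra hlt
  obtain ⟨M₁, -, hM₁, r, hr, himg⟩ := exists_augmentation (stateEdges A) _ (statePart M) N rfl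
    (isMatching_statePart hMm) hN (not_le.mp hlt)
  have hcov : ∀ i, ∃ l, (l, i) ∈ M := hMm.exists_of_card_eq (by simpa using hcard)
  have hinl : ∀ {j i}, (Sum.inl j, i) ∈ M → i ≠ r := fun {j i} h hi =>
    hr (Finset.mem_image.mpr ⟨(j, i), mem_statePart.mpr h, hi⟩)
  -- In `M` the vertex `r` is covered by an input edge. Now that `M₁` covers `r` and all right
  -- vertices of the state part, that edge can be dropped and the other input edges kept: the
  -- matching stays saturating and becomes strictly cheaper.
  set M₂ := M.filter fun e => e.1.isRight = true ∧ e.2 ≠ r with hM₂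
  let ι : Fin d × Fin d ↪ (Fin d ⊕ Fin m) × Fin d :=
    ⟨fun e => (Sum.inl e.1, e.2), fun a b h =>
      Prod.ext (Sum.inl.inj (Prod.mk.inj h).1) (Prod.mk.inj h).2⟩
  have hsnd : ∀ e ∈ M₁, ∀ e' ∈ M₂, e.2 ≠ e'.2 := by
    intro e he e' he' heq
    obtain ⟨h1, h2, h3⟩ := Finset.mem_filter.mp he'
    have : e.2 ∈ M₁.image Prod.snd := Finset.mem_image_of_mem _ he
    rw [himg, Finset.mem_insert] at this
    rcases this with h | h
    · exact h3 (heq ▸ h)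
    · obtain ⟨e₀, he₀, h⟩ := Finset.mem_image.mp h
      have h4 := hMm.injOn_snd h1 (mem_statePart.mp he₀) (heq.symm.trans h.symm)
      rw [h4] at h2
      exact absurd h2 (by simp)
  have hmatch : IsMatching (systemEdges A B) (M₁.map ι ∪ M₂) := by
    refine ⟨Finset.union_subset (fun e he => ?_) ((Finset.filter_subset _ _).trans hMm.1), ?_⟩
    · obtain ⟨e, he', rfl⟩ := Finset.mem_map.mp he
      exact mem_systemEdges_inl.mpr (by simpa [stateEdges] using hM₁.1 he')
    · intro a ha b hb hab
      rcases Finset.mem_union.mp ha with ha | ha <;> rcases Finset.mem_union.mp hb with hb | hb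
      · obtain ⟨a, ha', rfl⟩ := Finset.mem_map.mp ha
        obtain ⟨b, hb', rfl⟩ := Finset.mem_map.mp hb
        have := hM₁.2 a ha' b hb' fun h => hab (by rw [h])
        exact ⟨fun h => this.1 (Sum.inl.inj h), this.2⟩
      · obtain ⟨a, ha', rfl⟩ := Finset.mem_map.mp ha
        refine ⟨fun h => ?_, hsnd a ha' b hb⟩
        have := (Finset.mem_filter.mp hb).2.1
        rw [← h] at this
        exact Bool.false_ne_true this
      · obtain ⟨b, hb', rfl⟩ := Finset.mem_map.mp hb
        refine ⟨fun h => ?_, (hsnd b hb' a ha).symm⟩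
        have := (Finset.mem_filter.mp ha).2.1
        rw [h] at this
        exact Bool.false_ne_true this
      · exact hMm.2 a (Finset.mem_of_mem_filter a ha) b (Finset.mem_of_mem_filter b hb) hab
  have hfull : (M₁.map ι ∪ M₂).card = Fintype.card (Fin d) := by
    refine card_eq_of_forall_exists hmatch fun i => ?_
    by_cases hi : i ∈ M₁.image Prod.snd
    · obtain ⟨e, he, rfl⟩ := Finset.mem_image.mp hi
      exact ⟨_, Finset.mem_union_left _ (Finset.mem_map_of_mem ι he)⟩
    · rw [himg, Finset.mem_insert, not_or] at hi
      obtain ⟨l | k, hl⟩ := hcov i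
      · exact absurd (Finset.mem_image.mpr ⟨(l, i), mem_statePart.mpr hl, rfl⟩) hi.2
      · exact ⟨_, Finset.mem_union_right _ (Finset.mem_filter.mpr ⟨hl, rfl, hi.1⟩)⟩
  have hle := hM.2 _ (hmatch.isMaximum_of_card_eq hfull)
  obtain ⟨l | k, hk⟩ := hcov r
  · exact hinl hk rfl
  have hnonneg : ∀ e ∈ M, 0 ≤ edgeCost w e := by
    rintro ⟨l | k, i⟩ he
    · exact le_rfl
    · exact (hpos i k (mem_systemEdges_inr.mp (hMm.1 he))).le
  have hlt' : ∑ e ∈ M₂, edgeCost w e < ∑ e ∈ M, edgeCost w e :=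
    Finset.sum_lt_sum_of_subset (Finset.filter_subset _ _) hk
      (fun h => (Finset.mem_filter.mp h).2.2 rfl)
      (hpos r k (mem_systemEdges_inr.mp (hMm.1 hk))) fun e he _ => hnonneg e he
  rw [Finset.sum_union, Finset.sum_map,
    Finset.sum_eq_zero (s := M₁) (f := fun e => edgeCost w (ι e)) fun e _ => rfl, zero_add] at hle
  · exact absurd hle (not_le.mpr hlt')
  · rw [Finset.disjoint_left]
    intro a ha hb
    obtain ⟨a, ha', rfl⟩ := Finset.mem_map.mp ha
    exact hsnd a ha' _ hb rfl

/-- Both classes of `Γ(A)` have `d` vertices, so saturating the right one suffices. -/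
theorem isPerfectMatching_statePart {A : SparsityMatrix d d} {B : SparsityMatrix d m}
    {M : Finset ((Fin d ⊕ Fin m) × Fin d)} (hM : IsMatching (systemEdges A B) M)
    (hcov : ∀ i, ∃ j, (Sum.inl j, i) ∈ M) : IsPerfectMatching (stateEdges A) (statePart M) := by
  choose g hg using hcov
  have hinj : Function.Injective g := fun a b hab => by
    by_contra h
    exact (hM.2 _ (hg a) _ (hg b) fun h' => h (congrArg Prod.snd h')).1 (by rw [hab])
  refine ⟨isMatching_statePart hM, fun l => ?_, fun r => ⟨(g r, r), mem_statePart.mpr (hg r), rfl⟩⟩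
  obtain ⟨i, rfl⟩ := Finite.surjective_of_injective hinj l
  exact ⟨(g i, i), mem_statePart.mpr (hg i), rfl⟩

end StructuralControl

/-! ### Optimality of the cheapest maximum matching -/

theorem mainTheorem5 {d m : ℕ}
    (A : StructuralControl.SparsityMatrix d d) (B : StructuralControl.SparsityMatrix d m)
    (w : Matrix (Fin d) (Fin m) ℝ)
    (hctrl : StructuralControl.IsStructurallyControllable A B)
    (hconn : StructuralControl.IsStronglyConnected (StructuralControl.stateDigraph A))
    (hperf : ¬ ∃ N : Finset (Fin d × Fin d),
      StructuralControl.IsPerfectMatching (StructuralControl.stateEdges A) N)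
    (hpos : ∀ i j, B i j = true → 0 < w i j)
    (M : Finset ((Fin d ⊕ Fin m) × Fin d))
    (hM : StructuralControl.IsMinCostMaximumMatching (StructuralControl.systemEdges A B)
      (StructuralControl.edgeCost w) M) :
    StructuralControl.SolvesMinCost A B w (StructuralControl.inputMatrixOf M) ∧
    StructuralControl.SolvesSparsestMinCost A B w (StructuralControl.inputMatrixOf M) ∧
    StructuralControl.IsMaximumMatching (StructuralControl.stateEdges A)
      (StructuralControl.statePart M) := by
  open StructuralControl in
  have hMm := hM.1.1
  have hcard : M.card = d := by
    obtain ⟨N, hN, hNd⟩ := hctrl.exists_matching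
    have h1 := hM.1.2 N hN
    have h2 := hMm.card_le
    rw [Fintype.card_fin] at h2
    omega
  have hmax := isMaximumMatching_statePart hpos hM hcard
  have hadm : inputMatrixOf M ∈ admissible A B := by
    refine ⟨fun i k h => ?_, ?_⟩
    · by_contra h'
      rw [Bool.not_eq_false, inputMatrixOf_eq_true] at h'
      rw [mem_systemEdges_inr.mp (hMm.1 h')] at h
      exact absurd h (by decide)
    · have hcov := hMm.exists_of_card_eq (by simpa using hcard)
      choose f hf using hcov
      refine isStructurallyControllable_of_matching hconn f (fun a b hab => ?_)
        (fun i j h => mem_systemEdges_inl.mp (hMm.1 (h ▸ hf i)))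
        (fun i k h => inputMatrixOf_eq_true.mpr (h ▸ hf i)) ?_
      · by_contra h
        exact (hMm.2 _ (hf a) _ (hf b) fun h' => h (congrArg Prod.snd h')).1 hab
      -- Without an input edge, `M` would restrict to a perfect matching of `Γ(A)`.
      · by_contra hno
        refine hperf ⟨_, isPerfectMatching_statePart hMm fun i => ?_⟩
        rcases hfi : f i with j | k
        · exact ⟨j, hfi ▸ hf i⟩
        · exact absurd ⟨i, k, hfi⟩ hno
  have hcomp : ∀ B' ∈ admissible A B, nnz (inputMatrixOf M) ≤ nnz B' ∧
      weight w (inputMatrixOf M) ≤ weight w B' := by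
    rintro B' ⟨hB', hc⟩
    have hB'' : ∀ i k, B' i k = true → B i k = true := fun i k h => by
      by_contra h'
      rw [hB' i k (Bool.not_eq_true _ ▸ h')] at h
      exact absurd h (by decide)
    -- `N` lies in `Γ(A, B')`, so its input edges are entries of `B'`; comparing `M` with `N` bounds
    -- both the count and the cost.
    obtain ⟨N, hN, hNd⟩ := hc.exists_matching
    have hle : ∀ i k, inputMatrixOf N i k = true → B' i k = true := fun i k h =>
      mem_systemEdges_inr.mp (hN.1 (inputMatrixOf_eq_true.mp h))
    have hNB : IsMatching (systemEdges A B) N := by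
      refine ⟨fun e he => ?_, hN.2⟩
      obtain ⟨l | k, i⟩ := e
      · exact mem_systemEdges_inl.mpr (mem_systemEdges_inl.mp (hN.1 he))
      · exact mem_systemEdges_inr.mpr (hB'' _ _ (mem_systemEdges_inr.mp (hN.1 he)))
    constructor
    · refine le_trans ?_ (nnz_mono hle)
      have h1 := hmax.2 _ (isMatching_statePart hN)
      have h2 := card_eq_nnz_add_card_statePart M
      have h3 := card_eq_nnz_add_card_statePart N
      omega
    · refine le_trans ?_ (weight_mono hle fun i k h => (hpos i k (hB'' i k h)).le)
      rw [weight_inputMatrixOf, weight_inputMatrixOf]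
      exact hM.2 N (hNB.isMaximum_of_card_eq (by simpa using hNd))
  exact ⟨⟨hadm, fun B' h => (hcomp B' h).2⟩,
    ⟨⟨hadm, fun B' h => (hcomp B' h).1⟩, fun B' h => (hcomp B' h.1).2⟩, hmax⟩
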